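/- **Notation for perturbed linear programs.** Given $A^{(0)},A^{(1)}\in\mathbb R^{m\times n}$, $b^{(0)},b^{(1)}\in\mathbb R^m$, $c^{(0)},c^{(1)}\in\mathbb R^n$, let $\theta(\varepsilon)=\{x\ge 0: (A^{(0)}+\varepsilon A^{(1)})x=b^{(0)}+\varepsilon b^{(1)}\}$, let $F^*(\varepsilon)$ be the value of $\max\{\langle c^{(0)}+\varepsilon c^{(1)},x\rangle : x\in\theta(\varepsilon)\}$ and $\theta^*(\varepsilon)$ its set of optimal solutions. Let $J_0=\{j:\exists x\in\theta(0),\ x_j>0\}$, let $\Theta_1$ be the set of pairs $(x^0,x^1)$ with $x^0\in\theta(0)$, $A^{(0)}x^1+A^{(1)}x^0=b^{(1)}$ and $x^1_j\ge 0$ for $j\notin J_0$, and let $\theta_1=\{x^0:(x^0,x^1)\in\Theta_1 \text{ for some } x^1\}$. Consider the conditions: - $(H_0^*)$: there are $\gamma_0>0$ and a bounded set $B$ with $\theta^*(\varepsilon)\subset B$ for all $\varepsilon\in(0,\gamma_0]$; - $(H_1)$: $\operatorname{rank}A^{(0)}=m$; - ES-1: there is $(\hat x^0,\hat x^1)\in\Theta_1$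 with $\hat x^1_j>0$ for all $j\notin J_0$ and $\hat x^0_j>0$ for all $j\in J_0$. A vector $x$ is *feasible limiting optimal* if $x\in\liminf_{\varepsilon\downarrow0}\theta(\varepsilon)$ and $\lim_{\varepsilon\downarrow0}F^*(\varepsilon)=\langle c^{(0)},x\rangle$. Limits of sets are in the sense of Painlevé–Kuratowski. **Theorem.** Consider a Markov decision process with finite state space $X$, finite action sets $A(i)$, real rewards $r_{ia}$ and transition probabilities $p_{iaj}\ge 0$, $\sum_j p_{iaj}=1$, and let $\gamma_j>0$ for $j\in X$. For a discount factor $\alpha\in(0,1)$ consider the discounted LP $$\min\sum_j\gamma_j\tilde v_j\quad\text{s.t.}\quad \sum_j(\delta_{ij}-\alpha p_{iaj})\tilde v_j\ge r_{ia}\ \ \forall (i,a),\qquad \tilde v\ge 0 .$$ With $\varepsilon=(1-\alpha)/\alpha$, the substitution $v_j=\frac{\varepsilon}{1+\varepsilon}\tilde v_j$ together with slack variables $\sigma_{ia}$ is a bijection from its feasible set onto that of $$\min\sum_j\gamma_jv_j\quad\text{s.t.}\quad\sum_j[(1+\varepsilon)\delta_{ij}-p_{iaj}]v_j-\sigma_{ia}=\varepsilon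 r_{ia}\ \ \forall(i,a),\qquad v\ge0,\ \sigma\ge 0,\tag{1}$$ and multiplies the objective by $\frac{\varepsilon}{1+\varepsilon}$. Problem (1) is the perturbed LP in the variable $x=(v,\sigma)$ with $A^{(0)}=(\delta_{ij}-p_{iaj}\mid -I)$, $A^{(1)}=(\delta_{ij}\mid 0)$, $b^{(0)}=0$, $b^{(1)}=(r_{ia})$, $c^{(0)}=(-\gamma,0)$, $c^{(1)}=0$. This perturbed LP satisfies $(H_0^*)$, $(H_1)$ and ES-1. Moreover, consider the long-run average LP $$\min\sum_j\gamma_jv^0_j\quad\text{s.t.}\quad\begin{cases}\sum_j[\delta_{ij}-p_{iaj}]v^0_j-\sigma^0_{ia}=0,\\ v^0_i+\sum_j[\delta_{ij}-p_{iaj}]v^1_j-\sigma^1_{ia}=r_{ia}\end{cases}\ \forall(i,a),\qquad v^0,\sigma^0,v^1,\sigma^1\ge0,\tag{2}$$ which is the program $\max\{\langle c^{(0)},x^0\rangle: A^{(0)}x^0=b^{(0)},\ A^{(0)}x^1+A^{(1)}x^0=b^{(1)},\ x^0\ge0,\ x^1\ge0\}$ for these data, with $x^0=(v^0,\sigma^0)$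 and $x^1=(v^1,\sigma^1)$. The set of the $x^0$-components of its feasible points is $\theta_1$. Problem (2), and problem (1) for every $\varepsilon>0$, have optimal solutions, and (2) is the limiting LP of (1): - every point of $\limsup_{\varepsilon\downarrow0}\theta^*(\varepsilon)$, where $\theta^*(\varepsilon)$ is the set of optimal solutions of (1), is the component $(v^0,\sigma^0)$ of an optimal solution of (2); - the optimal value of (1) converges to the optimal value of (2) as $\varepsilon\downarrow0$; - the component $(v^0,\sigma^0)$ of every optimal solution of (2) is feasible limiting optimal for (1). -/

import Mathlib

open Filter Topology

noncomputable section

/-! ### Optimization over a set -/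

/-- The set of minimizers of `f` over `F`. -/
def minimizers {V : Type*} (F : Set V) (f : V → ℝ) : Set V :=
  {x | x ∈ F ∧ ∀ y ∈ F, f x ≤ f y}

/-- The set of maximizers of `f` over `F`. -/
def maximizers {V : Type*} (F : Set V) (f : V → ℝ) : Set V :=
  {x | x ∈ F ∧ ∀ y ∈ F, f y ≤ f x}

/-- The value of `min {f x : x ∈ F}`, as an extended real (`⊤` if `F` is empty). -/
def minValue {V : Type*} (F : Set V) (f : V → ℝ) : EReal :=
  ⨅ x ∈ F, ((f x : ℝ) : EReal)

/-- The value of `max {f x : x ∈ F}`, as an extended real (`⊥` if `F` is empty). -/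
def maxValue {V : Type*} (F : Set V) (f : V → ℝ) : EReal :=
  ⨆ x ∈ F, ((f x : ℝ) : EReal)

/-! ### Limits of sets as `ε ↓ 0` (Painlevé–Kuratowski) -/

/-- The outer limit `limsup_{ε ↓ 0} C(ε)`: the points all of whose neighbourhoods meet `C(ε)` for
arbitrarily small `ε > 0`, that is, the limits of sequences `x_k ∈ C(ε_k)` with `ε_k ↓ 0`. -/
def outerLimit {V : Type*} [TopologicalSpace V] (C : ℝ → Set V) : Set V :=
  {x | ∀ U ∈ 𝓝 x, ∃ᶠ ε in 𝓝[>] (0 : ℝ), (C ε ∩ U).Nonempty}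

/-- The inner limit `liminf_{ε ↓ 0} C(ε)`: the points all of whose neighbourhoods meet `C(ε)` for
all sufficiently small `ε > 0`. -/
def innerLimit {V : Type*} [TopologicalSpace V] (C : ℝ → Set V) : Set V :=
  {x | ∀ U ∈ 𝓝 x, ∀ᶠ ε in 𝓝[>] (0 : ℝ), (C ε ∩ U).Nonempty}

/-! ### Perturbed linear programs -/

/-- The data of the family of linear programs
`max ⟨c₀ + ε c₁, x⟩` subject to `(A₀ + ε A₁) x = b₀ + ε b₁`, `x ≥ 0`,
with constraints indexed by `m` and variables indexed by `n`. -/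
structure PerturbedLP (m n : Type*) where
  A₀ : Matrix m n ℝ
  A₁ : Matrix m n ℝ
  b₀ : m → ℝ
  b₁ : m → ℝ
  c₀ : n → ℝ
  c₁ : n → ℝ

namespace PerturbedLP

variable {m n : Type*} [Fintype m] [Fintype n]

/-- The feasible set `θ(ε)`. -/
def feasible (P : PerturbedLP m n) (ε : ℝ) : Set (n → ℝ) :=
  {x | (P.A₀ + ε • P.A₁).mulVec x = P.b₀ + ε • P.b₁ ∧ ∀ j, 0 ≤ x j}

/-- The objective function `⟨c₀ + ε c₁, x⟩`. -/
def objective (P : PerturbedLP m n) (ε : ℝ) (x : n → ℝ) : ℝ :=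
  (P.c₀ + ε • P.c₁) ⬝ᵥ x

/-- The solution set `θ*(ε)`. -/
def solutions (P : PerturbedLP m n) (ε : ℝ) : Set (n → ℝ) :=
  maximizers (P.feasible ε) (P.objective ε)

/-- The optimal value `F*(ε)`. -/
def value (P : PerturbedLP m n) (ε : ℝ) : EReal :=
  maxValue (P.feasible ε) (P.objective ε)

/-- `x` is feasible limiting optimal: `x ∈ liminf_{ε ↓ 0} θ(ε)` and
`lim_{ε ↓ 0} F*(ε) = ⟨c₀, x⟩`. -/
def FeasibleLimitingOptimal (P : PerturbedLP m n) (x : n → ℝ) : Prop :=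
  x ∈ innerLimit P.feasible ∧
    Tendsto P.value (𝓝[>] (0 : ℝ)) (𝓝 (((P.c₀ ⬝ᵥ x : ℝ) : EReal)))

/-- Assumption `(H₀*)`: the solution sets are uniformly bounded for small `ε > 0`. -/
def H0star (P : PerturbedLP m n) : Prop :=
  ∃ γ₀ : ℝ, 0 < γ₀ ∧ ∃ B : Set (n → ℝ), Bornology.IsBounded B ∧
    ∀ ε : ℝ, 0 < ε → ε ≤ γ₀ → P.solutions ε ⊆ B

/-- Assumption `(H₁)`: the matrix `A₀` has full row rank. -/
def H1 (P : PerturbedLP m n) : Prop :=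
  P.A₀.rank = Fintype.card m

/-- The index set `J₀` of the variables that are positive at some point of `θ(0)`. -/
def J₀ (P : PerturbedLP m n) : Set n :=
  {j | ∃ x ∈ P.feasible 0, 0 < x j}

/-- The set `Θ₁` of the pairs `(x⁰, x¹)` with `x⁰ ∈ θ(0)`, `A₀ x¹ + A₁ x⁰ = b₁` and `x¹_j ≥ 0` for
`j ∉ J₀`. -/
def Theta₁ (P : PerturbedLP m n) : Set ((n → ℝ) × (n → ℝ)) :=
  {y | y.1 ∈ P.feasible 0 ∧ P.A₀.mulVec y.2 + P.A₁.mulVec y.1 = P.b₁ ∧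
    ∀ j, j ∉ P.J₀ → 0 ≤ y.2 j}

/-- The set `θ₁` of the first components of `Θ₁`. -/
def theta₁ (P : PerturbedLP m n) : Set (n → ℝ) :=
  Prod.fst '' P.Theta₁

/-- The extended Slater condition of order 1. -/
def ES1 (P : PerturbedLP m n) : Prop :=
  ∃ y ∈ P.Theta₁, (∀ j, j ∉ P.J₀ → 0 < y.2 j) ∧ ∀ j, j ∈ P.J₀ → 0 < y.1 j

/-- The feasible set of the program
`max ⟨c₀, x⁰⟩` subject to `A₀ x⁰ = b₀`, `A₀ x¹ + A₁ x⁰ = b₁`, `x⁰ ≥ 0`, `x¹ ≥ 0`. -/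
def ThetaTilde₁ (P : PerturbedLP m n) : Set ((n → ℝ) × (n → ℝ)) :=
  {y | P.A₀.mulVec y.1 = P.b₀ ∧ P.A₀.mulVec y.2 + P.A₁.mulVec y.1 = P.b₁ ∧
    (∀ j, 0 ≤ y.1 j) ∧ ∀ j, 0 ≤ y.2 j}

end PerturbedLP

/-! ### Markov decision processes -/

/-- A finite Markov decision process with state space `S`, action sets `A i`, immediate rewards
`r i a` and transition probabilities `p i a j`. -/
structure MDP (S : Type*) [Fintype S] (A : S → Type*) where
  r : ∀ i, A i → ℝ
  p : ∀ i, A i → S → ℝ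
  p_nonneg : ∀ i a j, 0 ≤ p i a j
  p_sum : ∀ i a, ∑ j, p i a j = 1

/-- The index set of the variables `(v, σ)`: `v` is indexed by the states and the slack variable
`σ` by the state-action pairs. -/
abbrev SlackIndex (S : Type*) (A : S → Type*) : Type _ := S ⊕ (Σ i, A i)

namespace MDP

variable {S : Type*} [Fintype S] [DecidableEq S] {A : S → Type*}

/-- The feasible set of the linear program of the `α`-discounted process:
`∑_j (δ_ij - α p_iaj) v_j ≥ r_ia` for all `(i, a)`, and `v ≥ 0`. -/
def discFeasible (M : MDP S A) (α : ℝ) : Set (S → ℝ) :=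
  {v | (∀ i a, M.r i a ≤ ∑ j, ((if i = j then 1 else 0) - α * M.p i a j) * v j) ∧ ∀ j, 0 ≤ v j}

/-- The feasible set of the rescaled discounted program with slack variables, in the unknown
`x = (v, σ)`: `∑_j ((1 + ε) δ_ij - p_iaj) v_j - σ_ia = ε r_ia` for all `(i, a)`, `v ≥ 0`,
`σ ≥ 0`. -/
def discSlackFeasible (M : MDP S A) (ε : ℝ) : Set (SlackIndex S A → ℝ) :=
  {x | (∀ i a, ∑ j, ((1 + ε) * (if i = j then 1 else 0) - M.p i a j) * x (Sum.inl j)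
        - x (Sum.inr ⟨i, a⟩) = ε * M.r i a) ∧
      (∀ j, 0 ≤ x (Sum.inl j)) ∧ ∀ s, 0 ≤ x (Sum.inr s)}

/-- The change of variables `v = ε / (1 + ε) ṽ`, completed by the slack variables. -/
def rescale (M : MDP S A) (ε : ℝ) (w : S → ℝ) : SlackIndex S A → ℝ :=
  Sum.elim (fun j => ε / (1 + ε) * w j)
    (fun s => ∑ j, ((1 + ε) * (if s.1 = j then 1 else 0) - M.p s.1 s.2 j) * (ε / (1 + ε) * w j)
      - ε * M.r s.1 s.2)

/-- The feasible set of the linear program of the long-run average process with slack variables,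
in the unknowns `y = (x⁰, x¹)`, `x⁰ = (v⁰, σ⁰)`, `x¹ = (v¹, σ¹)`:
`∑_j (δ_ij - p_iaj) v⁰_j - σ⁰_ia = 0` and `v⁰_i + ∑_j (δ_ij - p_iaj) v¹_j - σ¹_ia = r_ia` for all
`(i, a)`, and `v⁰, σ⁰, v¹, σ¹ ≥ 0`. -/
def avgSlackFeasible (M : MDP S A) :
    Set ((SlackIndex S A → ℝ) × (SlackIndex S A → ℝ)) :=
  {y | (∀ i a, ∑ j, ((if i = j then 1 else 0) - M.p i a j) * y.1 (Sum.inl j)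
        - y.1 (Sum.inr ⟨i, a⟩) = 0) ∧
      (∀ i a, y.1 (Sum.inl i)
        + ∑ j, ((if i = j then 1 else 0) - M.p i a j) * y.2 (Sum.inl j)
        - y.2 (Sum.inr ⟨i, a⟩) = M.r i a) ∧
      (∀ j, 0 ≤ y.1 (Sum.inl j)) ∧ (∀ s, 0 ≤ y.1 (Sum.inr s)) ∧
      (∀ j, 0 ≤ y.2 (Sum.inl j)) ∧ ∀ s, 0 ≤ y.2 (Sum.inr s)}

/-- The cost `∑_j γ_j v_j` of `x = (v, σ)`. -/
def cost {S : Type*} [Fintype S] {A : S → Type*} (γ : S → ℝ) (x : SlackIndex S A → ℝ) : ℝ :=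
  ∑ j, γ j * x (Sum.inl j)

/-- The perturbed linear program of the process: `A₀ = (δ_ij - p_iaj | -I)`, `A₁ = (δ_ij | 0)`,
`b₀ = 0`, `b₁ = (r_ia)`; minimizing `∑_j γ_j v_j` is maximizing with `c₀ = (-γ, 0)`, `c₁ = 0`. -/
def perturbedLP [∀ i, DecidableEq (A i)] (M : MDP S A) (γ : S → ℝ) :
    PerturbedLP (Σ i, A i) (SlackIndex S A) where
  A₀ := Matrix.fromCols
    (Matrix.of fun s j => (if s.1 = j then 1 else 0) - M.p s.1 s.2 j) (-1)
  A₁ := Matrix.fromCols (Matrix.of fun s j => if s.1 = j then 1 else 0) 0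
  b₀ := 0
  b₁ := fun s => M.r s.1 s.2
  c₀ := Sum.elim (fun j => -γ j) 0
  c₁ := 0

end MDP

end

/-! Two approximations link (1) and (2).

From (1) to (2): let `x` be a limit of feasible points `z` of the perturbed programs. The quotients
`(z - x)/ε` solve `A₀ w = b₁ - A₁ z` with `w ≥ 0` off `J₀`. They may be unbounded, but the
right-hand sides admitting such a solution form a closed set (a projected polyhedron), so the
limiting system is solvable and `x ∈ θ₁` (`outerLimit_feasible_subset_theta₁`). Since `b₀ = 0`,
adding to `x¹` a large multiple of a point of `θ(0)` positive on `J₀` makes all its coordinates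
nonnegative, so `θ₁` is the projection of the feasible set of (2).

From (2) to (1): a feasible `(x⁰, x¹)` yields the path `x⁰ + ε x¹ + ε² (0, v¹)`, exactly feasible
for (1) (`exists_continuous_mem_discSlackFeasible`). Comparing minimizers of (1) with such paths
shows that their limits are optimal in (2).

A constant `v` above all rewards bounds the optimal cost uniformly in `ε`, and `γ > 0` turns this
into compactness. Cluster points of minimizers then give solvability of (2) and convergence of the
values. -/

/-! ### Closedness of projections of polyhedra -/

/-- If a subspace `W` of `ℝ^ι` meets the nonnegative orthant only in `0`, then the set of the
vectors dominated by an element of `W` is closed. -/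
theorem isClosed_setOf_exists_ge_of_nonneg_eq_zero {ι : Type*} [Fintype ι]
    (W : Submodule ℝ (ι → ℝ)) (hW : ∀ w ∈ W, 0 ≤ w → w = 0) :
    IsClosed {u : ι → ℝ | ∃ w ∈ W, u ≤ w} := by
  have hWc : IsClosed (W : Set (ι → ℝ)) := W.closed_of_finiteDimensional
  have hcont : Continuous fun w : ι → ℝ => ‖(fun t => max (-w t) 0 : ι → ℝ)‖ := by fun_prop
  -- On `W` the negative part controls the whole vector: its norm is positive on the compact unit
  -- sphere of `W`, and it is positively homogeneous.
  obtain ⟨c, hc, hcW⟩ : ∃ c : ℝ, 0 < c ∧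
      ∀ w ∈ W, c * ‖w‖ ≤ ‖(fun t => max (-w t) 0 : ι → ℝ)‖ := by
    have hK : IsCompact (Metric.sphere (0 : ι → ℝ) 1 ∩ W) := (isCompact_sphere _ _).inter_right hWc
    have key : ∃ c : ℝ, 0 < c ∧ ∀ w ∈ Metric.sphere (0 : ι → ℝ) 1 ∩ W,
        c ≤ ‖(fun t => max (-w t) 0 : ι → ℝ)‖ := by
      rcases (Metric.sphere (0 : ι → ℝ) 1 ∩ W).eq_empty_or_nonempty with h | h
      · exact ⟨1, one_pos, by simp [h]⟩
      obtain ⟨w₀, hw₀, hmin⟩ := hK.exists_isMinOn h hcont.continuousOn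
      refine ⟨_, ?_, fun w hw => hmin hw⟩
      refine norm_pos_iff.2 fun h0 => ?_
      have : w₀ = 0 := hW w₀ hw₀.2 fun t => by
        have := congrFun h0 t
        simp only [Pi.zero_apply] at this ⊢
        linarith [le_max_left (-w₀ t) 0]
      simpa [this] using hw₀.1
    obtain ⟨c, hc, h⟩ := key
    refine ⟨c, hc, fun w hw => ?_⟩
    rcases eq_or_ne w 0 with rfl | hw0
    · simp
    have hn : 0 < ‖w‖ := norm_pos_iff.2 hw0
    have := h (‖w‖⁻¹ • w) ⟨by simp [norm_smul, hn.ne'], W.smul_mem _ hw⟩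
    have e : (fun t => max (-(‖w‖⁻¹ • w) t) 0 : ι → ℝ) = ‖w‖⁻¹ • fun t => max (-w t) 0 := by
      ext t
      simp only [Pi.smul_apply, smul_eq_mul]
      rw [mul_max_of_nonneg _ _ (inv_nonneg.2 hn.le)]
      simp
    rw [e, norm_smul, norm_inv, norm_norm, inv_mul_eq_div, le_div_iff₀ hn] at this
    exact this
  refine isClosed_of_closure_subset fun u hu => ?_
  obtain ⟨x, hx, hxu⟩ := mem_closure_iff_seq_limit.1 hu
  choose w hwW hxw using hx
  obtain ⟨R, hR⟩ := (Metric.isBounded_range_of_tendsto x hxu).exists_norm_le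
  -- As `w n ≥ x n`, the negative part of `w n` is at most `‖x n‖ ≤ R`.
  have hb : ∀ n, w n ∈ Metric.closedBall (0 : ι → ℝ) (R / c) := fun n => by
    rw [mem_closedBall_zero_iff, le_div_iff₀ hc, mul_comm]
    refine (hcW _ (hwW n)).trans ?_
    have hxR : ‖x n‖ ≤ R := hR _ ⟨n, rfl⟩
    refine (pi_norm_le_iff_of_nonneg ((norm_nonneg _).trans hxR)).2 fun t => ?_
    rw [Real.norm_eq_abs, abs_of_nonneg (le_max_right _ _)]
    refine max_le ?_ ((norm_nonneg _).trans hxR)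
    have h1 := hxw n t
    have h2 := (norm_le_pi_norm (x n) t).trans hxR
    rw [Real.norm_eq_abs] at h2
    linarith [neg_abs_le (x n t)]
  obtain ⟨w', -, φ, hφ, hlim⟩ := (isCompact_closedBall _ _).tendsto_subseq hb
  exact ⟨w', hWc.mem_of_tendsto hlim (Eventually.of_forall fun n => hwW _),
    le_of_tendsto_of_tendsto' (hxu.comp hφ.tendsto_atTop) hlim fun n => hxw _⟩

/-- The set of the vectors dominated by an element of a subspace of `ℝ^ι` is closed. -/
theorem isClosed_setOf_exists_ge {ι : Type*} [Fintype ι] (W : Submodule ℝ (ι → ℝ)) :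
    IsClosed {u : ι → ℝ | ∃ w ∈ W, u ≤ w} := by
  induction hn : Fintype.card ι using Nat.strong_induction_on generalizing ι with
  | _ n ih =>
  classical
  by_cases hW : ∀ w ∈ W, 0 ≤ w → w = 0
  · exact isClosed_setOf_exists_ge_of_nonneg_eq_zero W hW
  push Not at hW
  obtain ⟨d, hdW, hd0, hd⟩ := hW
  obtain ⟨t₀, ht₀⟩ := Function.ne_iff.1 hd
  -- Adding large multiples of `d` satisfies every inequality with `d t > 0`, so only the
  -- coordinates where `d` vanishes matter, and there are fewer of them.
  let ρ : (ι → ℝ) →ₗ[ℝ] ({t // d t = 0} → ℝ) := LinearMap.funLeft ℝ ℝ Subtype.val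
  have hcard : Fintype.card {t // d t = 0} < n := by
    rw [← hn]
    exact Fintype.card_subtype_lt (x := t₀) ht₀
  have hcl := ih _ hcard (W.map ρ) rfl
  have hρ : Continuous ρ := ρ.continuous_of_finiteDimensional
  convert hcl.preimage hρ using 1
  ext u
  simp only [Set.mem_ofPred_eq, Set.mem_preimage]
  constructor
  · rintro ⟨w, hw, huw⟩
    exact ⟨ρ w, Submodule.mem_map_of_mem hw, fun t => huw t⟩
  · rintro ⟨_, ⟨w, hw, rfl⟩, huw⟩
    have hev : ∀ t, ∀ᶠ C : ℝ in atTop, u t ≤ w t + C * d t := fun t => by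
      rcases (hd0 t).eq_or_lt with h | h
      · have : u t ≤ w t := huw ⟨t, h.symm⟩
        refine Eventually.of_forall fun C => ?_
        rw [← h]
        simpa using this
      · exact (tendsto_atTop_add_const_left _ _
          (tendsto_id.atTop_mul_const h)).eventually_ge_atTop (u t)
    obtain ⟨C, hC⟩ := (eventually_all.2 hev).exists
    exact ⟨w + C • d, W.add_mem hw (W.smul_mem C hdW), fun t => hC t⟩

/-- The set of the right-hand sides for which a system of linear equations has a solution with
prescribed nonnegative coordinates is closed. -/
theorem Matrix.isClosed_setOf_exists_mulVec_eq {m n : Type*} [Fintype m] [Fintype n]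
    (A : Matrix m n ℝ) (N : Set n) :
    IsClosed {b : m → ℝ | ∃ w : n → ℝ, A.mulVec w = b ∧ ∀ j ∈ N, 0 ≤ w j} := by
  classical
  -- An equation is two opposite inequalities: the system is solvable for `b` exactly when `(b, -b,
  -- 0)` is dominated by an element of the range of `L`.
  let L : (n → ℝ) →ₗ[ℝ] (m ⊕ m ⊕ N → ℝ) := LinearMap.pi <| Sum.elim
    (fun i => (LinearMap.proj i).comp A.mulVecLin) <| Sum.elim
    (fun i => -(LinearMap.proj i).comp A.mulVecLin) fun j => LinearMap.proj (j : n)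
  have hf : Continuous fun b : m → ℝ => (Sum.elim b (Sum.elim (-b) 0) : m ⊕ m ⊕ N → ℝ) := by
    refine continuous_pi ?_
    rintro (i | i | j) <;> simp <;> fun_prop
  convert (isClosed_setOf_exists_ge (LinearMap.range L)).preimage hf using 1
  ext b
  simp only [Set.mem_ofPred_eq, Set.mem_preimage, LinearMap.mem_range, exists_exists_eq_and,
    Pi.le_def, Sum.forall]
  refine exists_congr fun w => ?_
  simp only [L, LinearMap.pi_apply, Sum.elim_inl, Sum.elim_inr, LinearMap.comp_apply,
    LinearMap.neg_apply, LinearMap.proj_apply, Matrix.mulVecLin_apply, Pi.neg_apply,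
    Pi.zero_apply, neg_le_neg_iff, Subtype.forall]
  constructor
  · rintro ⟨rfl, h⟩
    exact ⟨fun _ => le_rfl, fun _ => le_rfl, h⟩
  · rintro ⟨h1, h2, h⟩
    exact ⟨funext fun i => le_antisymm (h2 i) (h1 i), h⟩

/-! ### Outer limits -/

/-- Stated for pairs `(ε, z)`, so that closed conditions on the product pass to the limit without
extracting sequences. -/
theorem frequently_prod_of_mem_outerLimit {V : Type*} [TopologicalSpace V] {C : ℝ → Set V} {x : V}
    (hx : x ∈ outerLimit C) : ∃ᶠ q in 𝓝[>] (0 : ℝ) ×ˢ 𝓝 x, 0 < q.1 ∧ q.2 ∈ C q.1 := by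
  intro h
  obtain ⟨s, hs, U, hU, hsU⟩ := mem_prod_iff.1 h
  obtain ⟨ε, ⟨z, hz⟩, hε⟩ :=
    ((hx U hU).and_eventually (inter_mem hs self_mem_nhdsWithin)).exists
  exact hsU (Set.mk_mem_prod hε.1 hz.2) ⟨hε.2, hz.1⟩

/-- The finer filter `l` plays the role of a subsequence; `tendsto_cost` needs it. -/
theorem mem_outerLimit_of_mapClusterPt {V : Type*} [TopologicalSpace V] {C : ℝ → Set V} {x : V}
    {f : ℝ → V} {l : Filter ℝ} (hl : l ≤ 𝓝[>] (0 : ℝ)) (hf : ∀ᶠ ε in l, f ε ∈ C ε)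
    (hx : MapClusterPt x l f) : x ∈ outerLimit C := fun U hU =>
  (((mapClusterPt_iff_frequently.1 hx U hU).and_eventually hf).mono
    fun _ hε => ⟨_, hε.2, hε.1⟩).filter_mono hl

theorem outerLimit_mono {V : Type*} [TopologicalSpace V] {C D : ℝ → Set V} (h : ∀ ε, C ε ⊆ D ε) :
    outerLimit C ⊆ outerLimit D := fun _ hx U hU =>
  (hx U hU).mono fun ε hε => hε.mono (Set.inter_subset_inter_left _ (h ε))

/-! ### Optimal values -/

theorem minValue_eq_of_mem_minimizers {V : Type*} {F : Set V} {f : V → ℝ} {x : V}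
    (hx : x ∈ minimizers F f) : minValue F f = f x :=
  le_antisymm (iInf₂_le x hx.1) (le_iInf₂ fun y hy => EReal.coe_le_coe_iff.2 (hx.2 y hy))

theorem maxValue_eq_of_mem_maximizers {V : Type*} {F : Set V} {f : V → ℝ} {x : V}
    (hx : x ∈ maximizers F f) : maxValue F f = f x :=
  le_antisymm (iSup₂_le fun y hy => EReal.coe_le_coe_iff.2 (hx.2 y hy))
    (le_iSup₂ (f := fun y (_ : y ∈ F) => ((f y : ℝ) : EReal)) x hx.1)

/-! ### Perturbed linear programs -/

namespace PerturbedLP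

variable {m n : Type*} [Fintype n]

theorem mem_feasible_zero {P : PerturbedLP m n} {x : n → ℝ} :
    x ∈ P.feasible 0 ↔ P.A₀.mulVec x = P.b₀ ∧ ∀ j, 0 ≤ x j := by
  simp [feasible]

/-- Every limit of feasible points of the perturbed programs belongs to `θ₁`. -/
theorem outerLimit_feasible_subset_theta₁ [Fintype m] (P : PerturbedLP m n) :
    outerLimit P.feasible ⊆ P.theta₁ := by
  intro x hx
  have hfr := frequently_prod_of_mem_outerLimit hx
  have hle : 𝓝[>] (0 : ℝ) ×ˢ 𝓝 x ≤ 𝓝 ((0 : ℝ), x) := by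
    rw [nhds_prod_eq]
    exact prod_mono nhdsWithin_le_nhds le_rfl
  have hmul : ∀ (ε : ℝ) (z : n → ℝ), (P.A₀ + ε • P.A₁).mulVec z =
      P.A₀.mulVec z + ε • P.A₁.mulVec z := fun ε z => by
    rw [Matrix.add_mulVec, Matrix.smul_mulVec]
  have hA : ∀ A : Matrix m n ℝ, Continuous A.mulVec := fun A => by fun_prop
  have h0 : x ∈ P.feasible 0 := by
    have hcl : IsClosed {q : ℝ × (n → ℝ) | q.2 ∈ P.feasible q.1} := by
      have e : {q : ℝ × (n → ℝ) | q.2 ∈ P.feasible q.1} =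
          {q | P.A₀.mulVec q.2 + q.1 • P.A₁.mulVec q.2 = P.b₀ + q.1 • P.b₁} ∩
            ⋂ j, {q | 0 ≤ q.2 j} := by
        ext q
        simp [feasible, hmul]
      rw [e]
      refine (isClosed_eq ?_ (by fun_prop)).inter
        (isClosed_iInter fun j => isClosed_le (by fun_prop) (by fun_prop))
      exact ((hA _).comp continuous_snd).add
        (continuous_fst.smul ((hA _).comp continuous_snd))
    have hlim : Tendsto id (𝓝[>] (0 : ℝ) ×ˢ 𝓝 x) (𝓝 ((0 : ℝ), x)) := hle
    have hmem : ∃ᶠ q in 𝓝[>] (0 : ℝ) ×ˢ 𝓝 x, id q ∈ {q : ℝ × (n → ℝ) | q.2 ∈ P.feasible q.1} :=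
      hfr.mono fun q hq => hq.2
    exact hcl.mem_of_frequently_of_tendsto hmem hlim
  -- The quotient `(z - x)/ε` solves the system with `z` on the right; off `J₀` it is nonnegative
  -- because `x j = 0` there. Only the right-hand sides need to converge.
  have hw : ∃ w : n → ℝ, P.A₀.mulVec w = P.b₁ - P.A₁.mulVec x ∧ ∀ j ∈ (P.J₀)ᶜ, 0 ≤ w j := by
    have hf : Continuous fun q : ℝ × (n → ℝ) => P.b₁ - P.A₁.mulVec q.2 :=
      continuous_const.sub ((hA _).comp continuous_snd)
    suffices h : P.b₁ - P.A₁.mulVec x ∈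
        {b : m → ℝ | ∃ w : n → ℝ, P.A₀.mulVec w = b ∧ ∀ j ∈ (P.J₀)ᶜ, 0 ≤ w j} from h
    refine IsClosed.mem_of_frequently_of_tendsto
      (P.A₀.isClosed_setOf_exists_mulVec_eq (P.J₀)ᶜ) (hfr.mono ?_)
      ((hf.tendsto ((0 : ℝ), x)).mono_left hle)
    rintro ⟨ε, z⟩ ⟨hε : 0 < ε, hz⟩
    refine ⟨ε⁻¹ • (z - x), ?_, fun j hj => ?_⟩
    · have e1 := hz.1
      rw [hmul] at e1
      have e2 := (mem_feasible_zero.1 h0).1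
      rw [Matrix.mulVec_smul, Matrix.mulVec_sub, e2, eq_sub_of_add_eq e1]
      ext i
      simp only [Pi.smul_apply, Pi.sub_apply, Pi.add_apply, smul_eq_mul]
      field_simp
      ring
    · have hxj : x j = 0 := le_antisymm (not_lt.1 fun h => hj ⟨x, h0, h⟩) (h0.2 j)
      have := hz.2 j
      simp only [Pi.smul_apply, Pi.sub_apply, smul_eq_mul, hxj, sub_zero]
      positivity
  obtain ⟨w, hw, hwN⟩ := hw
  exact ⟨(x, w), ⟨h0, by simp [hw], hwN⟩, rfl⟩

/-- If `b₀ = 0`, some point of `θ(0)` is positive in all the coordinates of `J₀`. -/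
theorem exists_feasible_zero_pos (P : PerturbedLP m n) (hb : P.b₀ = 0) :
    ∃ x ∈ P.feasible 0, ∀ j ∈ P.J₀, 0 < x j := by
  classical
  have h : ∀ j, ∃ x ∈ P.feasible 0, j ∈ P.J₀ → 0 < x j := fun j => by
    by_cases hj : j ∈ P.J₀
    · obtain ⟨x, hx, hxj⟩ := hj
      exact ⟨x, hx, fun _ => hxj⟩
    · exact ⟨0, mem_feasible_zero.2 ⟨by simp [hb], fun _ => le_rfl⟩, fun h => (hj h).elim⟩
  choose x hx hxpos using h
  -- With `b₀ = 0` the set `θ(0)` is a convex cone, so one witness per coordinate can be summed.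
  refine ⟨∑ k, x k, mem_feasible_zero.2 ⟨?_, fun j => ?_⟩, fun j hj => ?_⟩
  · rw [Matrix.mulVec_sum, hb]
    exact Finset.sum_eq_zero fun k _ => by rw [(mem_feasible_zero.1 (hx k)).1, hb]
  · rw [Finset.sum_apply]
    exact Finset.sum_nonneg fun k _ => (hx k).2 j
  · rw [Finset.sum_apply]
    exact (hxpos j hj).trans_le
      (Finset.single_le_sum (f := fun k => x k j) (fun k _ => (hx k).2 j) (Finset.mem_univ j))

/-- If `b₀ = 0`, the sign constraints on `x¹` may be extended to all the coordinates without
changing the set of the first components. -/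
theorem theta₁_eq_image_ThetaTilde₁ (P : PerturbedLP m n) (hb : P.b₀ = 0) :
    P.theta₁ = Prod.fst '' P.ThetaTilde₁ := by
  apply Set.Subset.antisymm
  · rintro _ ⟨⟨x, w⟩, ⟨hx, hw, hN⟩, rfl⟩
    obtain ⟨z, hz, hzpos⟩ := P.exists_feasible_zero_pos hb
    -- Since `A₀ z = 0`, replacing `w` by `w + C z` keeps the equation.
    have hev : ∀ j, ∀ᶠ C : ℝ in atTop, 0 ≤ w j + C * z j := fun j => by
      by_cases hj : j ∈ P.J₀
      · exact (tendsto_atTop_add_const_left _ _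
          (tendsto_id.atTop_mul_const (hzpos j hj))).eventually_ge_atTop 0
      · filter_upwards [eventually_ge_atTop 0] with C hC
        exact add_nonneg (hN j hj) (mul_nonneg hC (hz.2 j))
    obtain ⟨C, hC⟩ := (eventually_all.2 hev).exists
    refine ⟨(x, w + C • z), ⟨(mem_feasible_zero.1 hx).1, ?_, hx.2, fun j => hC j⟩, rfl⟩
    simpa [Matrix.mulVec_add, Matrix.mulVec_smul, (mem_feasible_zero.1 hz).1, hb] using hw
  · rintro _ ⟨⟨x, w⟩, ⟨hx, hw, hx0, hw0⟩, rfl⟩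
    exact ⟨(x, w), ⟨mem_feasible_zero.2 ⟨hx, hx0⟩, hw, fun j _ => hw0 j⟩, rfl⟩

end PerturbedLP

/-! ### Expected values, and the constraints expressed through them -/

namespace MDP

variable {S : Type*} [Fintype S] {A : S → Type*}

/-- The expected value of `v` at the next state, when action `a` is taken in state `i`. -/
def expect (M : MDP S A) (i : S) (a : A i) (v : S → ℝ) : ℝ := ∑ j, M.p i a j * v j

theorem expect_add (M : MDP S A) (i : S) (a : A i) (v w : S → ℝ) :
    M.expect i a (v + w) = M.expect i a v + M.expect i a w := by
  simp [expect, mul_add, Finset.sum_add_distrib]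

theorem expect_smul (M : MDP S A) (i : S) (a : A i) (c : ℝ) (v : S → ℝ) :
    M.expect i a (c • v) = c * M.expect i a v := by
  simp only [expect, Pi.smul_apply, smul_eq_mul, Finset.mul_sum]
  exact Finset.sum_congr rfl fun j _ => by ring

theorem expect_const (M : MDP S A) (i : S) (a : A i) (c : ℝ) :
    M.expect i a (fun _ => c) = c := by
  rw [expect, ← Finset.sum_mul, M.p_sum, one_mul]

theorem expect_nonneg (M : MDP S A) (i : S) (a : A i) {v : S → ℝ} (hv : ∀ j, 0 ≤ v j) :
    0 ≤ M.expect i a v :=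
  Finset.sum_nonneg fun j _ => mul_nonneg (M.p_nonneg i a j) (hv j)

theorem continuous_cost (γ : S → ℝ) :
    Continuous (cost γ : (SlackIndex S A → ℝ) → ℝ) := by
  unfold cost
  fun_prop

theorem exists_reward_le [∀ i, Fintype (A i)] (M : MDP S A) :
    ∃ R : ℝ, 0 ≤ R ∧ ∀ i a, M.r i a ≤ R :=
  ⟨∑ s : Σ i, A i, |M.r s.1 s.2|, Finset.sum_nonneg fun _ _ => abs_nonneg _, fun i a =>
    (le_abs_self _).trans (Finset.single_le_sum (f := fun s : Σ i, A i => |M.r s.1 s.2|)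
      (fun _ _ => abs_nonneg _) (Finset.mem_univ ⟨i, a⟩))⟩

/-- A bound for the feasible points of the discounted program with cost at most `c`. -/
noncomputable def costBound (M : MDP S A) (γ : S → ℝ) (c : ℝ) (ε : ℝ) : SlackIndex S A → ℝ :=
  Sum.elim (fun j => c / γ j) fun s => (1 + ε) * (c / γ s.1) + ε * |M.r s.1 s.2|

theorem costBound_mono (M : MDP S A) {γ : S → ℝ} (hγ : ∀ j, 0 < γ j) {c : ℝ} (hc : 0 ≤ c) :
    Monotone (M.costBound γ c) := by
  rintro ε ε' h (j | s)
  · exact le_rfl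
  · have := hγ s.1
    simp only [costBound, Sum.elim_inr]
    gcongr

variable [DecidableEq S]

/-- The pairs `(1, α)`, `(1 + ε, 1)` and `(1, 1)` for `(c, d)` cover the discounted, rescaled and
average constraints. -/
theorem sum_coeff_mul (M : MDP S A) (c d : ℝ) (i : S) (a : A i) (v : S → ℝ) :
    ∑ j, (c * (if i = j then 1 else 0) - d * M.p i a j) * v j = c * v i - d * M.expect i a v := by
  simp [sub_mul, Finset.sum_sub_distrib, expect, Finset.mul_sum, mul_assoc]

theorem mem_discSlackFeasible {M : MDP S A} {ε : ℝ} {x : SlackIndex S A → ℝ} :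
    x ∈ M.discSlackFeasible ε ↔
      (∀ i a, (1 + ε) * x (Sum.inl i) - M.expect i a (fun j => x (Sum.inl j))
        - x (Sum.inr ⟨i, a⟩) = ε * M.r i a) ∧
      (∀ j, 0 ≤ x (Sum.inl j)) ∧ ∀ s, 0 ≤ x (Sum.inr s) := by
  have h := fun i a => M.sum_coeff_mul (1 + ε) 1 i a fun j => x (Sum.inl j)
  simp only [one_mul] at h
  simp only [discSlackFeasible, Set.mem_ofPred_eq, h]

theorem mem_avgSlackFeasible {M : MDP S A} {y : (SlackIndex S A → ℝ) × (SlackIndex S A → ℝ)} :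
    y ∈ M.avgSlackFeasible ↔
      (∀ i a, y.1 (Sum.inl i) - M.expect i a (fun j => y.1 (Sum.inl j))
        - y.1 (Sum.inr ⟨i, a⟩) = 0) ∧
      (∀ i a, y.1 (Sum.inl i) + (y.2 (Sum.inl i) - M.expect i a (fun j => y.2 (Sum.inl j)))
        - y.2 (Sum.inr ⟨i, a⟩) = M.r i a) ∧
      (∀ j, 0 ≤ y.1 (Sum.inl j)) ∧ (∀ s, 0 ≤ y.1 (Sum.inr s)) ∧
      (∀ j, 0 ≤ y.2 (Sum.inl j)) ∧ ∀ s, 0 ≤ y.2 (Sum.inr s) := by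
  have h := fun i a (x : SlackIndex S A → ℝ) => M.sum_coeff_mul 1 1 i a fun j => x (Sum.inl j)
  simp only [one_mul] at h
  simp only [avgSlackFeasible, Set.mem_ofPred_eq, h]

/-- The points with a constant `v` are feasible for `ε` as soon as the constant is at least all
the rewards. -/
theorem const_mem_discSlackFeasible (M : MDP S A) {ε R : ℝ}
    (hR : 0 ≤ R) (hr : ∀ i a, ε * M.r i a ≤ ε * R) :
    (Sum.elim (fun _ => R) (fun s => ε * (R - M.r s.1 s.2)) : SlackIndex S A → ℝ) ∈
      M.discSlackFeasible ε := by
  rw [mem_discSlackFeasible]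
  refine ⟨fun i a => ?_, fun _ => hR, fun s => ?_⟩
  · simp only [Sum.elim_inl, Sum.elim_inr, expect_const]
    ring
  · simp only [Sum.elim_inr]
    linarith [hr s.1 s.2]

/-! ### The change of variables -/

theorem mem_discFeasible {M : MDP S A} {α : ℝ} {v : S → ℝ} :
    v ∈ M.discFeasible α ↔ (∀ i a, M.r i a ≤ v i - α * M.expect i a v) ∧ ∀ j, 0 ≤ v j := by
  have h := fun i a => M.sum_coeff_mul 1 α i a v
  simp only [one_mul] at h
  simp only [discFeasible, Set.mem_ofPred_eq, h]

theorem rescale_inr (M : MDP S A) (ε : ℝ) (w : S → ℝ) (s : Σ i, A i) :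
    M.rescale ε w (Sum.inr s) = ε / (1 + ε) * ((1 + ε) * w s.1 - M.expect s.1 s.2 w)
      - ε * M.r s.1 s.2 := by
  have h := M.sum_coeff_mul (1 + ε) 1 s.1 s.2 ((ε / (1 + ε)) • w)
  simp only [one_mul, Pi.smul_apply, smul_eq_mul, expect_smul] at h
  simp only [rescale, Sum.elim_inr, h]
  ring

theorem cost_rescale (M : MDP S A) (γ : S → ℝ) (ε : ℝ) (w : S → ℝ) :
    cost γ (M.rescale ε w) = ε / (1 + ε) * ∑ j, γ j * w j := by
  simp only [cost, rescale, Sum.elim_inl, Finset.mul_sum]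
  exact Finset.sum_congr rfl fun j _ => by ring

/-- Since `α = 1 / (1 + ε)`, the slack in (1) is `ε` times the surplus in the discounted constraint.
The equations determine `σ` from `v`, so inverting only requires undoing the scaling of `v`. -/
theorem bijOn_rescale (M : MDP S A) {α ε : ℝ} (hα : 0 < α) (hα1 : α < 1)
    (hε : ε = (1 - α) / α) :
    Set.BijOn (M.rescale ε) (M.discFeasible α) (M.discSlackFeasible ε) := by
  have hε0 : 0 < ε := hε ▸ div_pos (by linarith) hα
  have hα' : α = 1 / (1 + ε) := by
    rw [hε]
    field_simp
    ring
  have hk : 0 < ε / (1 + ε) := by positivity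
  refine ⟨fun w hw => ?_, fun w _ w' _ h => ?_, fun x hx => ?_⟩
  · rw [mem_discFeasible] at hw
    rw [mem_discSlackFeasible]
    refine ⟨fun i a => ?_, fun j => mul_nonneg hk.le (hw.2 j), fun s => ?_⟩
    · have e : M.expect i a (fun j => M.rescale ε w (Sum.inl j)) =
          ε / (1 + ε) * M.expect i a w := M.expect_smul i a _ w
      rw [rescale_inr, e]
      simp only [rescale, Sum.elim_inl]
      ring
    · rw [rescale_inr]
      have h := mul_le_mul_of_nonneg_left (hw.1 s.1 s.2) hε0.le
      have e : ε / (1 + ε) * ((1 + ε) * w s.1 - M.expect s.1 s.2 w) =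
          ε * (w s.1 - α * M.expect s.1 s.2 w) := by
        rw [hα']
        field_simp
      linarith
  · funext j
    exact mul_left_cancel₀ hk.ne' (congrFun h (Sum.inl j))
  · rw [mem_discSlackFeasible] at hx
    obtain ⟨h1, h2, h3⟩ := hx
    have hv : (fun j => x (Sum.inl j)) = (ε / (1 + ε)) • fun j => (1 + ε) / ε * x (Sum.inl j) := by
      funext j
      simp only [Pi.smul_apply, smul_eq_mul]
      field_simp
    have he : ∀ i a, M.expect i a (fun j => (1 + ε) / ε * x (Sum.inl j)) =
        (1 + ε) / ε * M.expect i a fun j => x (Sum.inl j) := fun i a =>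
      M.expect_smul i a _ fun j => x (Sum.inl j)
    refine ⟨fun j => (1 + ε) / ε * x (Sum.inl j), ?_, ?_⟩
    · rw [mem_discFeasible]
      refine ⟨fun i a => ?_, fun j => mul_nonneg (by positivity) (h2 j)⟩
      rw [he, hα', ← sub_nonneg]
      have e : (1 + ε) / ε * x (Sum.inl i) - 1 / (1 + ε) * ((1 + ε) / ε *
          M.expect i a fun j => x (Sum.inl j)) - M.r i a = x (Sum.inr ⟨i, a⟩) / ε := by
        have := h1 i a
        field_simp
        linarith
      rw [e]
      exact div_nonneg (h3 _) hε0.le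
    · funext t
      rcases t with j | ⟨i, a⟩
      · exact (congrFun hv j).symm
      · rw [rescale_inr, he]
        have := h1 i a
        field_simp
        linarith

/-! ### The perturbed linear program -/

section PerturbedLP

variable [∀ i, DecidableEq (A i)]

theorem perturbedLP_objective [∀ i, Fintype (A i)] (M : MDP S A) (γ : S → ℝ) (ε : ℝ)
    (x : SlackIndex S A → ℝ) : (M.perturbedLP γ).objective ε x = -cost γ x := by
  simp [PerturbedLP.objective, perturbedLP, dotProduct, cost]

theorem perturbedLP_c₀_dotProduct [∀ i, Fintype (A i)] (M : MDP S A) (γ : S → ℝ)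
    (x : SlackIndex S A → ℝ) : (M.perturbedLP γ).c₀ ⬝ᵥ x = -cost γ x := by
  simp [perturbedLP, dotProduct, cost]

theorem perturbedLP_A₀_mulVec [∀ i, Fintype (A i)] (M : MDP S A) (γ : S → ℝ)
    (x : SlackIndex S A → ℝ) (s : Σ i, A i) : (M.perturbedLP γ).A₀.mulVec x s =
      x (Sum.inl s.1) - M.expect s.1 s.2 (fun j => x (Sum.inl j)) - x (Sum.inr s) := by
  have h := M.sum_coeff_mul 1 1 s.1 s.2 fun j => x (Sum.inl j)
  simp only [one_mul] at h
  rw [← h]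
  simp [perturbedLP, Matrix.mulVec, dotProduct, Matrix.one_apply, sub_eq_add_neg]

theorem perturbedLP_A₁_mulVec [∀ i, Fintype (A i)] (M : MDP S A) (γ : S → ℝ)
    (x : SlackIndex S A → ℝ) (s : Σ i, A i) :
    (M.perturbedLP γ).A₁.mulVec x s = x (Sum.inl s.1) := by
  simp [perturbedLP, Matrix.mulVec, dotProduct]

theorem perturbedLP_feasible [∀ i, Fintype (A i)] (M : MDP S A) (γ : S → ℝ) (ε : ℝ) :
    (M.perturbedLP γ).feasible ε = M.discSlackFeasible ε := by
  ext x
  rw [mem_discSlackFeasible]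
  simp only [PerturbedLP.feasible, Set.mem_ofPred_eq, funext_iff, Sigma.forall, Sum.forall,
    Matrix.add_mulVec, Matrix.smul_mulVec, Pi.add_apply, Pi.smul_apply, smul_eq_mul,
    perturbedLP_A₀_mulVec, perturbedLP_A₁_mulVec]
  refine and_congr_left' (forall₂_congr fun i a => ?_)
  simp only [perturbedLP, Pi.zero_apply, zero_add]
  rw [show (1 + ε) * x (Sum.inl i) = x (Sum.inl i) + ε * x (Sum.inl i) by ring]
  constructor <;> intro h <;> linarith

theorem perturbedLP_ThetaTilde₁ [∀ i, Fintype (A i)] (M : MDP S A) (γ : S → ℝ) :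
    (M.perturbedLP γ).ThetaTilde₁ = M.avgSlackFeasible := by
  ext y
  rw [mem_avgSlackFeasible]
  simp only [PerturbedLP.ThetaTilde₁, Set.mem_ofPred_eq, funext_iff, Sigma.forall, Sum.forall,
    Pi.add_apply, perturbedLP_A₀_mulVec, perturbedLP_A₁_mulVec, and_assoc]
  refine and_congr (by simp [perturbedLP]) (and_congr_left' (forall₂_congr fun i a => ?_))
  simp only [perturbedLP]
  constructor <;> intro h <;> linarith

theorem perturbedLP_theta₁ [∀ i, Fintype (A i)] (M : MDP S A) (γ : S → ℝ) :
    (M.perturbedLP γ).theta₁ = Prod.fst '' M.avgSlackFeasible := by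
  rw [PerturbedLP.theta₁_eq_image_ThetaTilde₁ _ rfl, perturbedLP_ThetaTilde₁]

theorem perturbedLP_solutions [∀ i, Fintype (A i)] (M : MDP S A) (γ : S → ℝ) (ε : ℝ) :
    (M.perturbedLP γ).solutions ε = minimizers (M.discSlackFeasible ε) (cost γ) := by
  ext x
  simp only [PerturbedLP.solutions, maximizers, minimizers, Set.mem_ofPred_eq,
    perturbedLP_feasible, perturbedLP_objective, neg_le_neg_iff]

theorem perturbedLP_H1 [∀ i, Fintype (A i)] (M : MDP S A) (γ : S → ℝ) :
    (M.perturbedLP γ).H1 := by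
  have h : LinearMap.range (M.perturbedLP γ).A₀.mulVecLin = ⊤ := by
    -- The slack block `-I` is already onto.
    refine LinearMap.range_eq_top.2 fun b => ⟨Sum.elim 0 (-b), ?_⟩
    ext s
    rw [Matrix.mulVecLin_apply, perturbedLP_A₀_mulVec]
    simp [expect]
  rw [PerturbedLP.H1, Matrix.rank, h, finrank_top, Module.finrank_fintype_fun_eq_card]

/-- The transition probabilities sum to `1`, so `v = 1`, `σ = 0` lies in `θ(0)`. Hence only slack
indices can lie outside `J₀`. -/
theorem perturbedLP_inl_mem_J₀ [∀ i, Fintype (A i)] (M : MDP S A) (γ : S → ℝ) (j : S) :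
    Sum.inl j ∈ (M.perturbedLP γ).J₀ :=
  ⟨_, perturbedLP_feasible M γ 0 ▸
    M.const_mem_discSlackFeasible zero_le_one (by simp), one_pos⟩

theorem perturbedLP_ES1 [∀ i, Fintype (A i)] (M : MDP S A) (γ : S → ℝ) :
    (M.perturbedLP γ).ES1 := by
  obtain ⟨z, hz, hzpos⟩ := (M.perturbedLP γ).exists_feasible_zero_pos rfl
  obtain ⟨R, hR, hr⟩ := M.exists_reward_le
  have hc := M.const_mem_discSlackFeasible (ε := 0) hR (by simp)
  rw [← M.perturbedLP_feasible γ, PerturbedLP.mem_feasible_zero] at hc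
  have hz' := PerturbedLP.mem_feasible_zero.1 hz
  have hσ : ∀ s : Σ i, A i, 0 < z (Sum.inl s.1) + R - M.r s.1 s.2 := fun s => by
    linarith [hzpos _ (M.perturbedLP_inl_mem_J₀ γ s.1), hr s.1 s.2]
  refine ⟨(z + _, Sum.elim 0 fun s => z (Sum.inl s.1) + R - M.r s.1 s.2),
    ⟨PerturbedLP.mem_feasible_zero.2 ⟨?_, fun j => add_nonneg (hz'.2 j) (hc.2 j)⟩, ?_, ?_⟩,
    ?_, fun j hj => add_pos_of_pos_of_nonneg (hzpos j hj) (hc.2 j)⟩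
  · rw [Matrix.mulVec_add, hz'.1, hc.1]
    exact add_zero _
  · ext s
    simp only [Pi.add_apply, perturbedLP_A₀_mulVec, perturbedLP_A₁_mulVec, Sum.elim_inl,
      Sum.elim_inr, Pi.zero_apply]
    simp [perturbedLP, expect]
  · rintro (j | s) hj
    · exact (hj (M.perturbedLP_inl_mem_J₀ γ j)).elim
    · exact (hσ s).le
  · rintro (j | s) hj
    · exact (hj (M.perturbedLP_inl_mem_J₀ γ j)).elim
    · exact hσ s

end PerturbedLP

/-! ### Optimal solutions of the discounted program -/

/-- Each term of the cost is nonnegative, hence at most `c`. The equation then bounds `σ` once the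
nonnegative expectation is dropped. -/
theorem le_costBound (M : MDP S A) {γ : S → ℝ} (hγ : ∀ j, 0 < γ j) {c ε : ℝ} (hε : 0 ≤ ε)
    {x : SlackIndex S A → ℝ} (hx : x ∈ M.discSlackFeasible ε) (hc : cost γ x ≤ c) :
    x ≤ M.costBound γ c ε := by
  rw [mem_discSlackFeasible] at hx
  obtain ⟨h1, h2, h3⟩ := hx
  have hv : ∀ j, x (Sum.inl j) ≤ c / γ j := fun j => by
    rw [le_div_iff₀' (hγ j)]
    exact (Finset.single_le_sum (f := fun j => γ j * x (Sum.inl j))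
      (fun k _ => mul_nonneg (hγ k).le (h2 k)) (Finset.mem_univ j)).trans hc
  rintro (j | ⟨i, a⟩)
  · exact hv j
  · have e := h1 i a
    have h4 := M.expect_nonneg i a h2
    have h5 := mul_le_mul_of_nonneg_left (hv i) (by linarith : 0 ≤ 1 + ε)
    have h6 := mul_le_mul_of_nonneg_left (neg_abs_le (M.r i a)) hε
    simp only [costBound, Sum.elim_inr]
    linarith

theorem nonneg_of_mem_discSlackFeasible {M : MDP S A} {ε : ℝ} {x : SlackIndex S A → ℝ}
    (hx : x ∈ M.discSlackFeasible ε) : 0 ≤ x := by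
  rintro (j | s)
  · exact hx.2.1 j
  · exact hx.2.2 s

theorem isClosed_discSlackFeasible (M : MDP S A) (ε : ℝ) : IsClosed (M.discSlackFeasible ε) := by
  have e : M.discSlackFeasible ε = (⋂ i, ⋂ a, {x | ∑ j, ((1 + ε) * (if i = j then 1 else 0)
      - M.p i a j) * x (Sum.inl j) - x (Sum.inr ⟨i, a⟩) = ε * M.r i a}) ∩
      ((⋂ j, {x | 0 ≤ x (Sum.inl j)}) ∩ ⋂ s, {x | 0 ≤ x (Sum.inr s)}) := by
    ext x
    simp [discSlackFeasible]
  rw [e]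
  refine (isClosed_iInter fun i => isClosed_iInter fun a =>
    isClosed_eq (by fun_prop) (by fun_prop)).inter (IsClosed.inter ?_ ?_)
  · exact isClosed_iInter fun j => isClosed_le (by fun_prop) (by fun_prop)
  · exact isClosed_iInter fun j => isClosed_le (by fun_prop) (by fun_prop)

/-- A constant `v` above all rewards works for every `ε`; only its slack changes, which carries no
cost. -/
theorem exists_cost_le [∀ i, Fintype (A i)] (M : MDP S A) {γ : S → ℝ} (hγ : ∀ j, 0 < γ j) :
    ∃ c : ℝ, 0 ≤ c ∧ ∀ ε : ℝ, 0 ≤ ε → ∃ x ∈ M.discSlackFeasible ε, cost γ x = c := by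
  obtain ⟨R, hR, hr⟩ := M.exists_reward_le
  exact ⟨∑ j, γ j * R, Finset.sum_nonneg fun j _ => mul_nonneg (hγ j).le hR, fun ε hε =>
    ⟨_, M.const_mem_discSlackFeasible hR
      fun i a => mul_le_mul_of_nonneg_left (hr i a) hε, rfl⟩⟩

theorem minimizers_discSlackFeasible_nonempty [∀ i, Fintype (A i)] (M : MDP S A) {γ : S → ℝ}
    (hγ : ∀ j, 0 < γ j) {ε : ℝ} (hε : 0 ≤ ε) :
    (minimizers (M.discSlackFeasible ε) (cost γ)).Nonempty := by
  obtain ⟨c, -, hc⟩ := M.exists_cost_le hγ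
  obtain ⟨x₀, hx₀, hx₀c⟩ := hc ε hε
  have hK : IsCompact (M.discSlackFeasible ε ∩ Set.Icc 0 (M.costBound γ c ε)) :=
    isCompact_Icc.inter_left (M.isClosed_discSlackFeasible ε)
  have hmem : ∀ x ∈ M.discSlackFeasible ε, cost γ x ≤ c →
      x ∈ M.discSlackFeasible ε ∩ Set.Icc 0 (M.costBound γ c ε) := fun x hx hxc =>
    ⟨hx, nonneg_of_mem_discSlackFeasible hx, M.le_costBound hγ hε hx hxc⟩
  obtain ⟨x, hx, hmin⟩ := hK.exists_isMinOn ⟨x₀, hmem x₀ hx₀ hx₀c.le⟩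
    (continuous_cost γ).continuousOn
  refine ⟨x, hx.1, fun y hy => ?_⟩
  rcases le_total (cost γ y) c with h | h
  · exact hmin (hmem y hy h)
  · exact (hmin (hmem x₀ hx₀ hx₀c.le)).trans (hx₀c.le.trans h)

/-- For `ε ∈ [0, 1]`, the optimal solutions of the discounted program stay in a compact set. -/
theorem exists_isCompact_minimizers_subset [∀ i, Fintype (A i)] (M : MDP S A) {γ : S → ℝ}
    (hγ : ∀ j, 0 < γ j) : ∃ K : Set (SlackIndex S A → ℝ), IsCompact K ∧
      ∀ ε : ℝ, 0 ≤ ε → ε ≤ 1 → minimizers (M.discSlackFeasible ε) (cost γ) ⊆ K := by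
  obtain ⟨c, hc0, hc⟩ := M.exists_cost_le hγ
  refine ⟨Set.Icc 0 (M.costBound γ c 1), isCompact_Icc, fun ε hε hε1 x hx =>
    ⟨nonneg_of_mem_discSlackFeasible hx.1, ?_⟩⟩
  obtain ⟨x₀, hx₀, hx₀c⟩ := hc ε hε
  exact (M.le_costBound hγ hε hx.1 (hx₀c ▸ hx.2 x₀ hx₀)).trans (M.costBound_mono hγ hc0 hε1)

theorem perturbedLP_H0star [∀ i, Fintype (A i)] [∀ i, DecidableEq (A i)] (M : MDP S A)
    {γ : S → ℝ} (hγ : ∀ j, 0 < γ j) : (M.perturbedLP γ).H0star := by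
  obtain ⟨K, hK, h⟩ := M.exists_isCompact_minimizers_subset hγ
  exact ⟨1, one_pos, K, hK.isBounded, fun ε hε hε1 =>
    perturbedLP_solutions M γ ε ▸ h ε hε.le hε1⟩

/-! ### The limiting program -/

/-- Every feasible point of the average program is the end point of a continuous path of feasible
points of the discounted programs. -/
theorem exists_continuous_mem_discSlackFeasible (M : MDP S A)
    {y : (SlackIndex S A → ℝ) × (SlackIndex S A → ℝ)} (hy : y ∈ M.avgSlackFeasible) :
    ∃ z : ℝ → SlackIndex S A → ℝ, Continuous z ∧ z 0 = y.1 ∧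
      ∀ ε, 0 < ε → z ε ∈ M.discSlackFeasible ε := by
  rw [mem_avgSlackFeasible] at hy
  obtain ⟨h1, h2, h3, h4, h5, h6⟩ := hy
  -- The first-order path leaves the error `ε² A₁ x¹ = ε² v¹`; the slack absorbs it and stays
  -- nonnegative because `v¹ ≥ 0`.
  refine ⟨fun ε => y.1 + ε • y.2 + ε ^ 2 • (Sum.elim 0 fun s => y.2 (Sum.inl s.1) : SlackIndex S A → ℝ),
    by fun_prop, by simp, fun ε hε => ?_⟩
  rw [mem_discSlackFeasible]
  refine ⟨fun i a => ?_, fun j => ?_, fun s => ?_⟩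
  · have e : M.expect i a (fun j => (y.1 + ε • y.2 + ε ^ 2 • (Sum.elim 0 fun s =>
        y.2 (Sum.inl s.1) : SlackIndex S A → ℝ)) (Sum.inl j)) =
        M.expect i a (fun j => y.1 (Sum.inl j)) + ε * M.expect i a (fun j => y.2 (Sum.inl j)) := by
      rw [← expect_smul, ← expect_add]
      congr 1
      funext j
      simp
    rw [e]
    simp only [Pi.add_apply, Pi.smul_apply, smul_eq_mul, Sum.elim_inl, Sum.elim_inr,
      Pi.zero_apply]
    linear_combination h1 i a + ε * h2 i a
  · have := h3 j
    have := h5 j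
    simp only [Pi.add_apply, Pi.smul_apply, smul_eq_mul, Sum.elim_inl, Pi.zero_apply]
    positivity
  · have := h4 s
    have := h5 s.1
    have := h6 s
    simp only [Pi.add_apply, Pi.smul_apply, smul_eq_mul, Sum.elim_inr]
    positivity

theorem fst_mem_innerLimit (M : MDP S A)
    {y : (SlackIndex S A → ℝ) × (SlackIndex S A → ℝ)} (hy : y ∈ M.avgSlackFeasible) :
    y.1 ∈ innerLimit M.discSlackFeasible := by
  obtain ⟨z, hz, hz0, hzf⟩ := M.exists_continuous_mem_discSlackFeasible hy
  intro U hU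
  have : ∀ᶠ ε in 𝓝[>] (0 : ℝ), z ε ∈ U :=
    nhdsWithin_le_nhds (hz.continuousAt.preimage_mem_nhds (hz0.symm ▸ hU))
  filter_upwards [this, self_mem_nhdsWithin] with ε hε hpos
  exact ⟨z ε, hzf ε hpos, hε⟩

/-- Limits of optimal solutions of the discounted programs are components of optimal solutions of
the average program. -/
theorem outerLimit_minimizers_subset [∀ i, Fintype (A i)] (M : MDP S A) (γ : S → ℝ) :
    outerLimit (fun ε => minimizers (M.discSlackFeasible ε) (cost γ)) ⊆
      Prod.fst '' minimizers M.avgSlackFeasible (fun y => cost γ y.1) := by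
  classical
  intro x hx
  have hx' : x ∈ Prod.fst '' M.avgSlackFeasible := by
    rw [← M.perturbedLP_theta₁ γ]
    refine PerturbedLP.outerLimit_feasible_subset_theta₁ _ (outerLimit_mono (fun ε => ?_) hx)
    rw [perturbedLP_feasible]
    exact fun _ h => h.1
  obtain ⟨y, hy, rfl⟩ := hx'
  refine ⟨y, ⟨hy, fun y' hy' => ?_⟩, rfl⟩
  obtain ⟨z, hz, hz0, hzf⟩ := M.exists_continuous_mem_discSlackFeasible hy'
  have hle : 𝓝[>] (0 : ℝ) ×ˢ 𝓝 y.1 ≤ 𝓝 ((0 : ℝ), y.1) := by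
    rw [nhds_prod_eq]
    exact prod_mono nhdsWithin_le_nhds le_rfl
  have hcl : IsClosed {q : ℝ × (SlackIndex S A → ℝ) | cost γ q.2 ≤ cost γ (z q.1)} :=
    isClosed_le ((continuous_cost γ).comp continuous_snd)
      ((continuous_cost γ).comp (hz.comp continuous_fst))
  -- Each minimizer of (1) costs no more than the path leading to the competitor `y'`.
  have hmem : ∃ᶠ q in 𝓝[>] (0 : ℝ) ×ˢ 𝓝 y.1,
      id q ∈ {q : ℝ × (SlackIndex S A → ℝ) | cost γ q.2 ≤ cost γ (z q.1)} :=
    (frequently_prod_of_mem_outerLimit hx).mono fun q hq => hq.2.2 _ (hzf _ hq.1)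
  have hlim : Tendsto id (𝓝[>] (0 : ℝ) ×ˢ 𝓝 y.1) (𝓝 ((0 : ℝ), y.1)) := hle
  have h : cost γ y.1 ≤ cost γ (z 0) := hcl.mem_of_frequently_of_tendsto hmem hlim
  rwa [hz0] at h

theorem eventually_mem_Ioc_zero_one : ∀ᶠ ε in 𝓝[>] (0 : ℝ), ε ∈ Set.Ioc (0 : ℝ) 1 :=
  Ioc_mem_nhdsGT one_pos

/-- The cost does not control `x¹`, so a solution is obtained instead from a cluster point of the
minimizers of (1). -/
theorem minimizers_avgSlackFeasible_nonempty [∀ i, Fintype (A i)] (M : MDP S A) {γ : S → ℝ}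
    (hγ : ∀ j, 0 < γ j) : (minimizers M.avgSlackFeasible (fun y => cost γ y.1)).Nonempty := by
  obtain ⟨K, hK, hKε⟩ := M.exists_isCompact_minimizers_subset hγ
  have hne : ∀ ε : ℝ, ∃ x, 0 < ε → x ∈ minimizers (M.discSlackFeasible ε) (cost γ) := fun ε => by
    by_cases hε : 0 < ε
    · obtain ⟨x, hx⟩ := M.minimizers_discSlackFeasible_nonempty hγ hε.le
      exact ⟨x, fun _ => hx⟩
    · exact ⟨0, fun h => (hε h).elim⟩
  choose f hf using hne
  obtain ⟨x, -, hx⟩ := hK.exists_mapClusterPt_of_frequently (l := 𝓝[>] (0 : ℝ)) (f := f)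
    (eventually_mem_Ioc_zero_one.mono fun ε hε => hKε ε hε.1.le hε.2 (hf ε hε.1)).frequently
  obtain ⟨y, hy, -⟩ := M.outerLimit_minimizers_subset γ
    (mem_outerLimit_of_mapClusterPt le_rfl (eventually_mem_Ioc_zero_one.mono
      fun ε hε => hf ε hε.1) hx)
  exact ⟨y, hy⟩

/-- The costs of optimal solutions of the discounted programs converge to the optimal cost of the
average program. -/
theorem tendsto_cost [∀ i, Fintype (A i)] (M : MDP S A) {γ : S → ℝ}
    (hγ : ∀ j, 0 < γ j) {f : ℝ → SlackIndex S A → ℝ}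
    (hf : ∀ ε, 0 < ε → f ε ∈ minimizers (M.discSlackFeasible ε) (cost γ))
    {y : (SlackIndex S A → ℝ) × (SlackIndex S A → ℝ)}
    (hy : y ∈ minimizers M.avgSlackFeasible (fun y => cost γ y.1)) :
    Tendsto (fun ε => cost γ (f ε)) (𝓝[>] 0) (𝓝 (cost γ y.1)) := by
  refine tendsto_order.2 ⟨fun c hc => ?_, fun c hc => ?_⟩
  · by_contra hcon
    obtain ⟨K, hK, hKε⟩ := M.exists_isCompact_minimizers_subset hγ
    -- If costs at most `c` recur, a cluster point along those `ε` gives a feasible point of (2)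
    -- cheaper than the optimum.
    let l := 𝓝[>] (0 : ℝ) ⊓ 𝓟 {ε | cost γ (f ε) ≤ c}
    have hfr : ∃ᶠ ε in 𝓝[>] (0 : ℝ), cost γ (f ε) ≤ c := by simpa using hcon
    have : l.NeBot := frequently_mem_iff_neBot.1 hfr
    have hle : l ≤ 𝓝[>] (0 : ℝ) := inf_le_left
    have hlpos := eventually_mem_Ioc_zero_one.filter_mono hle
    obtain ⟨x, -, hx⟩ := hK.exists_mapClusterPt_of_frequently (l := l) (f := f)
      (hlpos.mono fun ε hε => hKε ε hε.1.le hε.2 (hf ε hε.1)).frequently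
    obtain ⟨y', hy', rfl⟩ := M.outerLimit_minimizers_subset γ
      (mem_outerLimit_of_mapClusterPt hle (hlpos.mono fun ε hε => hf ε hε.1) hx)
    have hcl : IsClosed {x : SlackIndex S A → ℝ | cost γ x ≤ c} :=
      isClosed_le (continuous_cost γ) continuous_const
    have hlc : ∀ᶠ ε in l, f ε ∈ {x : SlackIndex S A → ℝ | cost γ x ≤ c} :=
      (eventually_principal.2 fun ε hε => hε : ∀ᶠ ε in 𝓟 {ε | cost γ (f ε) ≤ c},
        f ε ∈ {x : SlackIndex S A → ℝ | cost γ x ≤ c}).filter_mono inf_le_right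
    have hyc : cost γ y'.1 ≤ c :=
      isClosed_iff_clusterPt.1 hcl _ (ClusterPt.mono hx (le_principal_iff.2 hlc))
    exact absurd (hy.2 y' hy'.1) (not_le.2 (hyc.trans_lt hc))
  -- The path leading to the optimal `y` bounds the costs from above.
  · obtain ⟨z, hz, hz0, hzf⟩ := M.exists_continuous_mem_discSlackFeasible hy.1
    have hlim : Tendsto (fun ε => cost γ (z ε)) (𝓝[>] 0) (𝓝 (cost γ y.1)) := by
      rw [← hz0]
      exact (((continuous_cost γ).comp hz).tendsto 0).mono_left nhdsWithin_le_nhds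
    filter_upwards [hlim.eventually_lt_const hc, self_mem_nhdsWithin] with ε hε hpos
    exact ((hf ε hpos).2 _ (hzf ε hpos)).trans_lt hε

theorem tendsto_minValue [∀ i, Fintype (A i)] (M : MDP S A) {γ : S → ℝ} (hγ : ∀ j, 0 < γ j) :
    Tendsto (fun ε => minValue (M.discSlackFeasible ε) (cost γ)) (𝓝[>] 0)
      (𝓝 (minValue M.avgSlackFeasible (fun y => cost γ y.1))) := by
  have hne := fun (ε : ℝ) (hε : 0 < ε) => M.minimizers_discSlackFeasible_nonempty hγ hε.le
  classical
  let f : ℝ → SlackIndex S A → ℝ := fun ε => if h : 0 < ε then (hne ε h).some else 0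
  have hf : ∀ ε, 0 < ε → f ε ∈ minimizers (M.discSlackFeasible ε) (cost γ) := fun ε hε => by
    simp only [f, hε, dif_pos]
    exact (hne ε hε).some_mem
  obtain ⟨y, hy⟩ := M.minimizers_avgSlackFeasible_nonempty hγ
  rw [minValue_eq_of_mem_minimizers hy]
  refine ((continuous_coe_real_ereal.tendsto _).comp (M.tendsto_cost hγ hf hy)).congr' ?_
  filter_upwards [self_mem_nhdsWithin] with ε hε
  exact (minValue_eq_of_mem_minimizers (hf ε hε)).symm

theorem perturbedLP_value [∀ i, Fintype (A i)] [∀ i, DecidableEq (A i)] (M : MDP S A) {γ : S → ℝ}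
    (hγ : ∀ j, 0 < γ j) {ε : ℝ} (hε : 0 ≤ ε) :
    (M.perturbedLP γ).value ε = -minValue (M.discSlackFeasible ε) (cost γ) := by
  obtain ⟨x, hx⟩ := M.minimizers_discSlackFeasible_nonempty hγ hε
  rw [minValue_eq_of_mem_minimizers hx]
  rw [← M.perturbedLP_solutions γ] at hx
  rw [PerturbedLP.value, maxValue_eq_of_mem_maximizers hx, perturbedLP_objective, EReal.coe_neg]

theorem feasibleLimitingOptimal_fst [∀ i, Fintype (A i)] [∀ i, DecidableEq (A i)] (M : MDP S A)
    {γ : S → ℝ} (hγ : ∀ j, 0 < γ j) {y : (SlackIndex S A → ℝ) × (SlackIndex S A → ℝ)}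
    (hy : y ∈ minimizers M.avgSlackFeasible (fun y => cost γ y.1)) :
    (M.perturbedLP γ).FeasibleLimitingOptimal y.1 := by
  refine ⟨?_, ?_⟩
  · rw [show (M.perturbedLP γ).feasible = M.discSlackFeasible from
      funext (M.perturbedLP_feasible γ)]
    exact M.fst_mem_innerLimit hy.1
  · rw [perturbedLP_c₀_dotProduct, EReal.coe_neg]
    have h := M.tendsto_minValue hγ
    rw [minValue_eq_of_mem_minimizers hy] at h
    refine ((continuous_neg.tendsto _).comp h).congr' ?_
    filter_upwards [self_mem_nhdsWithin] with ε hε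
    exact (M.perturbedLP_value hγ (le_of_lt hε)).symm

end MDP

theorem mainTheorem4 {S : Type*} [Fintype S] [DecidableEq S] {A : S → Type*}
    [∀ i, Fintype (A i)] [∀ i, DecidableEq (A i)] (M : MDP S A)
    (γ : S → ℝ) (hγ : ∀ j, 0 < γ j) :
    -- with `ε = (1 - α) / α`, the discounted program becomes the program with slack variables
    (∀ α : ℝ, 0 < α → α < 1 → ∀ ε : ℝ, ε = (1 - α) / α →
      Set.BijOn (M.rescale ε) (M.discFeasible α) (M.discSlackFeasible ε) ∧
      ∀ w : S → ℝ, MDP.cost γ (M.rescale ε w) = ε / (1 + ε) * ∑ j, γ j * w j) ∧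
    -- the latter is a perturbed linear program
    (∀ ε : ℝ, (M.perturbedLP γ).feasible ε = M.discSlackFeasible ε ∧
      ∀ x, (M.perturbedLP γ).objective ε x = -MDP.cost γ x) ∧
    -- the program of the long-run average process is the associated limiting program
    (M.perturbedLP γ).ThetaTilde₁ = M.avgSlackFeasible ∧
    (M.perturbedLP γ).theta₁ = Prod.fst '' M.avgSlackFeasible ∧
    -- the assumptions hold
    (M.perturbedLP γ).H0star ∧ (M.perturbedLP γ).H1 ∧ (M.perturbedLP γ).ES1 ∧
    -- both problems have optimal solutions
    (∀ ε : ℝ, 0 < ε → (minimizers (M.discSlackFeasible ε) (MDP.cost γ)).Nonempty) ∧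
    (minimizers M.avgSlackFeasible (fun y => MDP.cost γ y.1)).Nonempty ∧
    -- convergence of the optimal solutions and of the optimal values
    outerLimit (fun ε => minimizers (M.discSlackFeasible ε) (MDP.cost γ)) ⊆
      Prod.fst '' minimizers M.avgSlackFeasible (fun y => MDP.cost γ y.1) ∧
    Filter.Tendsto (fun ε => minValue (M.discSlackFeasible ε) (MDP.cost γ))
      (nhdsWithin (0 : ℝ) (Set.Ioi 0))
      (nhds (minValue M.avgSlackFeasible (fun y => MDP.cost γ y.1))) ∧
    -- optimal solutions of the limiting program are feasible limiting optimal
    (∀ x ∈ Prod.fst '' minimizers M.avgSlackFeasible (fun y => MDP.cost γ y.1),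
      (M.perturbedLP γ).FeasibleLimitingOptimal x) :=
  ⟨fun _ hα hα1 _ hε => ⟨M.bijOn_rescale hα hα1 hε, M.cost_rescale γ _⟩,
    fun ε => ⟨M.perturbedLP_feasible γ ε, M.perturbedLP_objective γ ε⟩,
    M.perturbedLP_ThetaTilde₁ γ, M.perturbedLP_theta₁ γ,
    M.perturbedLP_H0star hγ, M.perturbedLP_H1 γ, M.perturbedLP_ES1 γ,
    fun _ hε => M.minimizers_discSlackFeasible_nonempty hγ hε.le,
    M.minimizers_avgSlackFeasible_nonempty hγ, M.outerLimit_minimizers_subset γ,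
    M.tendsto_minValue hγ, by
      rintro _ ⟨y, hy, rfl⟩
      exact M.feasibleLimitingOptimal_fst hγ hy⟩
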